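/- **Proposition.** Let $k$ be a field. By a $k$-group we mean an affine group scheme over $k$. Let $\phi_1\colon H\to G_1$ and $\phi_2\colon H\to G_2$ be morphisms of $k$-groups, and let $G_1*_H G_2$ be an amalgamated free product of $G_1$ and $G_2$ over $H$, i.e. a pushout of $\phi_1$ and $\phi_2$ in the category of $k$-groups. If $G_1$ and $G_2$ are geometrically reduced (that is, their base changes to every field extension of $k$ are reduced schemes), then $G_1*_H G_2$ is geometrically reduced. -/

import Mathlib

open CategoryTheory AlgebraicGeometry

universe u

/-- The property of a group scheme over a field `k` that its underlying scheme is affine. -/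
def affineGroupProperty (k : Type u) [Field k] :
    ObjectProperty (Grp (Over (Spec (CommRingCat.of k)))) :=
  fun G => IsAffine G.X.left

/-- The category of `k`-groups, that is, of affine group schemes over the field `k`:
the full subcategory of the category of group objects in schemes over `Spec k` whose objects
have an affine underlying scheme. Morphisms are the morphisms of group schemes over `k`. -/
abbrev KGroup (k : Type u) [Field k] : Type (u + 1) :=
  (affineGroupProperty k).FullSubcategory

namespace KGroup

/-- A `k`-group `G` is geometrically reduced if its structure morphism `G ⟶ Spec k` is, i.e. if
for every field extension `K` of `k` the base change of `G` to `K` is a reduced scheme. -/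
def IsGeometricallyReduced {k : Type u} [Field k] (G : KGroup k) : Prop :=
  GeometricallyReduced G.obj.X.hom

/-- `P`, together with `i₁ : G₁ ⟶ P` and `i₂ : G₂ ⟶ P`, is an amalgamated free product
`G₁ *_H G₂` of `φ₁ : H ⟶ G₁` and `φ₂ : H ⟶ G₂`: it is a pushout in the category of `k`-groups. -/
def IsAmalgamatedFreeProduct {k : Type u} [Field k] {H G₁ G₂ P : KGroup k}
    (φ₁ : H ⟶ G₁) (φ₂ : H ⟶ G₂) (i₁ : G₁ ⟶ P) (i₂ : G₂ ⟶ P) : Prop :=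
  IsPushout φ₁ φ₂ i₁ i₂

end KGroup

/-!
Every affine group scheme `P` over a field `k` has a largest geometrically reduced closed subgroup
`Q`, and every homomorphism to `P` from a geometrically reduced affine group scheme factors
through `Q` (`KGroup.exists_largest_geometricallyReduced`). If `P` is a pushout of `G₁` and `G₂`
over `H` with both `Gᵢ` geometrically reduced, then the maps `Gᵢ ⟶ P` factor through `Q`, and the
universal property of `P` gives a section of the monomorphism `Q ⟶ P`. Hence `Q ≅ P`, and `P` is
geometrically reduced.

The underlying scheme of `Q` exists for every affine scheme `Spec A` over `k`: among the ideals
`I` of `A` such that `K ⊗ A ⧸ I` is reduced for all field extensions `K` of `k` there is a smallest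
one, because over a field a jointly injective family of linear maps stays jointly injective after
tensoring (`rTensor_jointly_injective`). The same fact shows that the tensor product of a
universally reduced algebra and a reduced algebra is reduced, so products of geometrically reduced
affine `k`-schemes are geometrically reduced. The unit, multiplication and inversion of `P`,
restricted to `𝟙_`, `Q ⊗ Q` and `Q`, are therefore morphisms from geometrically reduced schemes;
they factor through `Q` and make it a group object (`CategoryTheory.GrpObj.ofMono`).
-/

open scoped TensorProduct

/-! ### Algebras that stay reduced under extension of the base field -/

/-- A jointly injective family of linear maps over a field remains jointly injective after
tensoring with an arbitrary vector space. -/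
theorem rTensor_jointly_injective {k R A : Type*} [Field k] [CommRing R] [Algebra k R]
    [AddCommGroup A] [Module k A] {ι : Type*} {S : ι → Type*} [∀ i, CommRing (S i)]
    [∀ i, Algebra k (S i)] (f : ∀ i, R →ₗ[k] S i)
    (hf : ∀ r, (∀ i, f i r = 0) → r = 0) (x : R ⊗[k] A)
    (hx : ∀ i, (f i).rTensor A x = 0) : x = 0 := by
  let b := Module.Basis.ofVectorSpace k A
  -- The maps `f i` act on the coordinates with respect to a basis of `A`.
  have key (i) (j) (y : R ⊗[k] A) :
      (b.baseChange (S i)).repr ((f i).rTensor A y) j = f i ((b.baseChange R).repr y j) := by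
    induction y with
    | zero => simp
    | tmul r a => simp
    | add y z hy hz => simp only [map_add, Finsupp.add_apply, hy, hz]
  refine (b.baseChange R).ext_elem fun j ↦ ?_
  rw [map_zero, Finsupp.zero_apply]
  exact hf _ fun i ↦ by rw [← key, hx]; simp

/-- A `k`-algebra `A` over a field is universally reduced if `K ⊗ A` is reduced for every field
extension `K` of `k`. The fields `K` range over the universe of `k` and `A`, as in the definition
of a geometrically reduced morphism of schemes. -/
def Algebra.IsUniversallyReduced (k A : Type u) [Field k] [CommRing A] [Algebra k A] : Prop :=
  ∀ (K : Type u) [Field K] [Algebra k K], IsReduced (K ⊗[k] A)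

namespace Algebra.IsUniversallyReduced

variable {k A B R : Type u} [Field k] [CommRing A] [Algebra k A] [CommRing B] [Algebra k B]
  [CommRing R] [Algebra k R]

theorem of_injective (hB : IsUniversallyReduced k B) (f : A →ₐ[k] B)
    (hf : Function.Injective f) : IsUniversallyReduced k A := fun K _ _ ↦
  have := hB K
  isReduced_of_injective (Algebra.TensorProduct.map (AlgHom.id k K) f)
    (Module.Flat.lTensor_preserves_injective_linearMap f.toLinearMap hf)

/-- A universally reduced algebra stays reduced after tensoring with any reduced algebra `R`,
since `R` embeds into the product of the residue fields of its primes. -/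
theorem isReduced_tensorProduct (hA : IsUniversallyReduced k A) [IsReduced R] :
    IsReduced (R ⊗[k] A) := by
  refine ⟨fun x hx ↦ ?_⟩
  refine rTensor_jointly_injective (ι := PrimeSpectrum R)
    (S := fun p ↦ p.asIdeal.ResidueField)
    (fun p ↦ (IsScalarTower.toAlgHom k R p.asIdeal.ResidueField).toLinearMap) ?_ x ?_
  · -- An element vanishing in all residue fields lies in every prime, hence is nilpotent.
    intro r hr
    refine IsNilpotent.eq_zero (nilpotent_iff_mem_prime.mpr fun p hp ↦ ?_)
    simpa using hr ⟨p, hp⟩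
  · intro p
    have := hA p.asIdeal.ResidueField
    exact (hx.map (Algebra.TensorProduct.map
      (IsScalarTower.toAlgHom k R p.asIdeal.ResidueField) (AlgHom.id k A))).eq_zero

theorem tensorProduct (hA : IsUniversallyReduced k A) (hB : IsUniversallyReduced k B) :
    IsUniversallyReduced k (A ⊗[k] B) := fun K _ _ ↦
  have := hA K
  have : IsReduced ((K ⊗[k] A) ⊗[k] B) := hB.isReduced_tensorProduct
  isReduced_of_injective (Algebra.TensorProduct.assoc k k k K A B).symm
    (Algebra.TensorProduct.assoc k k k K A B).symm.injective

variable (k A) in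
/-- The smallest ideal of `A` with universally reduced quotient. -/
def ideal : Ideal A := sInf {I | IsUniversallyReduced k (A ⧸ I)}

variable (k A) in
/-- The maps from `A ⧸ ideal k A` to all universally reduced quotients of `A` are jointly injective,
and remain so after tensoring with `K`. -/
theorem quotient_ideal : IsUniversallyReduced k (A ⧸ ideal k A) := fun K _ _ ↦ by
  refine ⟨fun x hx ↦ ?_⟩
  let f (I : {I : Ideal A | IsUniversallyReduced k (A ⧸ I)}) : A ⧸ ideal k A →ₐ[k] A ⧸ I.1 :=
    Ideal.Quotient.factorₐ k (sInf_le I.2)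
  refine (TensorProduct.comm k K (A ⧸ ideal k A)).injective ?_
  rw [map_zero]
  refine rTensor_jointly_injective (fun I ↦ (f I).toLinearMap) ?_ _ fun I ↦ ?_
  · intro r hr
    obtain ⟨a, rfl⟩ := Ideal.Quotient.mk_surjective r
    refine Ideal.Quotient.eq_zero_iff_mem.mpr (Submodule.mem_sInf.mpr fun I hI ↦ ?_)
    exact Ideal.Quotient.eq_zero_iff_mem.mp (hr ⟨I, hI⟩)
  · have := I.2 K
    have hx' := (hx.map (Algebra.TensorProduct.map (AlgHom.id k K) (f I))).eq_zero
    exact (TensorProduct.map_comm (f I).toLinearMap LinearMap.id x).trans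
      ((TensorProduct.comm k K (A ⧸ I.1)).map_eq_zero_iff.mpr hx')

theorem ideal_le_ker (hB : IsUniversallyReduced k B) (f : A →ₐ[k] B) :
    ideal k A ≤ RingHom.ker f :=
  sInf_le (hB.of_injective (Ideal.kerLiftAlg f) (Ideal.kerLiftAlg_injective f))

end Algebra.IsUniversallyReduced

/-! ### Subgroup objects -/

section GrpObj

open MonoidalCategory CartesianMonoidalCategory MonObj

variable {C : Type*} [Category C] [CartesianMonoidalCategory C]

/-- A subobject of a group object through which the unit, the multiplication and the inversion
factor is a group object. -/
abbrev CategoryTheory.GrpObj.ofMono {Q G : C} [GrpObj G] (j : Q ⟶ G) [Mono j] (one : 𝟙_ C ⟶ Q)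
    (mul : Q ⊗ Q ⟶ Q) (inv : Q ⟶ Q) (h_one : one ≫ j = η) (h_mul : mul ≫ j = (j ⊗ₘ j) ≫ μ)
    (h_inv : inv ≫ j = j ≫ ι) : GrpObj Q where
  one := one
  mul := mul
  inv := inv
  one_mul := by
    rw [← cancel_mono j, Category.assoc, h_mul, ← Category.assoc, whiskerRight_comp_tensorHom,
      h_one]
    simp [MonoidalCategory.tensorHom_def']
  mul_one := by
    rw [← cancel_mono j, Category.assoc, h_mul, ← Category.assoc, whiskerLeft_comp_tensorHom,
      h_one]
    simp [MonoidalCategory.tensorHom_def]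
  mul_assoc := by
    rw [← cancel_mono j]
    simp only [Category.assoc, h_mul]
    have h_left : mul ▷ Q ≫ (j ⊗ₘ j) = ((j ⊗ₘ j) ⊗ₘ j) ≫ μ ▷ G := by
      rw [whiskerRight_comp_tensorHom, h_mul, tensorHom_comp_whiskerRight]
    have h_right : Q ◁ mul ≫ (j ⊗ₘ j) = (j ⊗ₘ j ⊗ₘ j) ≫ G ◁ μ := by
      rw [whiskerLeft_comp_tensorHom, h_mul, tensorHom_comp_whiskerLeft]
    rw [reassoc_of% h_left, reassoc_of% h_right, MonObj.mul_assoc, associator_naturality_assoc]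
  left_inv := by
    rw [← cancel_mono j]
    simp [h_mul, h_one, h_inv]
  right_inv := by
    rw [← cancel_mono j]
    simp [h_mul, h_one, h_inv]

end GrpObj

/-! ### Geometrically reduced affine schemes over a field -/

namespace AlgebraicGeometry

section

open MonoidalCategory CartesianMonoidalCategory

variable {k : Type u} [Field k]

theorem geometricallyReduced_Spec_iff {A : Type u} [CommRing A] [Algebra k A] :
    GeometricallyReduced (Spec.map (CommRingCat.ofHom (algebraMap k A))) ↔
      Algebra.IsUniversallyReduced k A := by
  -- The definition forms the base change on the right, while `K ⊗[k] A` has `K` on the left.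
  have h_iff (K : Type u) [Field K] [Algebra k K] :
      IsReduced (Limits.pullback (Spec.map (CommRingCat.ofHom (algebraMap k A)))
        (Spec.map (CommRingCat.ofHom (algebraMap k K)))) ↔ _root_.IsReduced (K ⊗[k] A) := by
    rw [← affine_isReduced_iff (CommRingCat.of (K ⊗[k] A))]
    let e := Limits.pullbackSymmetry (Spec.map (CommRingCat.ofHom (algebraMap k A)))
        (Spec.map (CommRingCat.ofHom (algebraMap k K))) ≪≫ pullbackSpecIso k K A
    exact ⟨fun _ ↦ isReduced_of_isOpenImmersion e.inv, fun _ ↦ isReduced_of_isOpenImmersion e.hom⟩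
  have : ObjectProperty.IsClosedUnderIsomorphisms (C := Scheme.{u}) IsReduced :=
    ⟨fun e _ ↦ isReduced_of_isOpenImmersion e.inv⟩
  rw [geometricallyReduced_iff, geometrically_iff_of_commRing_of_isClosedUnderIsomorphisms]
  exact forall_congr' fun K ↦ forall_congr' fun _ ↦ forall_congr' fun _ ↦ h_iff K

theorem geometricallyReduced_iff_of_iso {X Y : Over (Spec (CommRingCat.of k))} (e : X ≅ Y) :
    GeometricallyReduced X.hom ↔ GeometricallyReduced Y.hom := by
  have h {X Y : Over (Spec (CommRingCat.of k))} (e : X ≅ Y) (hX : GeometricallyReduced X.hom) :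
      GeometricallyReduced Y.hom :=
    have : IsIso e.inv.left := inferInstanceAs (IsIso ((Over.forget _).map e.inv))
    MorphismProperty.of_isPullback (P := @GeometricallyReduced)
      (IsPullback.of_horiz_isIso ⟨(by simp : e.inv.left ≫ X.hom = Y.hom ≫ 𝟙 _)⟩) hX
  exact ⟨h e, h e.symm⟩

theorem geometricallyReduced_iff_of_iso_Spec {X : Over (Spec (CommRingCat.of k))} {A : Type u}
    [CommRing A] [Algebra k A] (e : X ≅ Over.mk (Spec.map (CommRingCat.ofHom (algebraMap k A)))) :
    GeometricallyReduced X.hom ↔ Algebra.IsUniversallyReduced k A :=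
  (geometricallyReduced_iff_of_iso e).trans geometricallyReduced_Spec_iff

/-- An affine scheme over `k` is the spectrum of a `k`-algebra. -/
theorem exists_iso_Spec (X : Over (Spec (CommRingCat.of k))) [IsAffine X.left] :
    ∃ (A : Type u) (_ : CommRing A) (_ : Algebra k A),
      Nonempty (X ≅ Over.mk (Spec.map (CommRingCat.ofHom (algebraMap k A)))) := by
  obtain ⟨φ, hφ⟩ := Spec.map_surjective (X.left.isoSpec.inv ≫ X.hom)
  algebraize [φ.hom]
  exact ⟨Γ(X.left, ⊤), inferInstance, φ.hom.toAlgebra, ⟨Over.isoMk X.left.isoSpec (by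
    change _ ≫ Spec.map φ = _
    simp [hφ])⟩⟩

/-- The product of two geometrically reduced affine schemes over a field is geometrically
reduced; no Noetherian hypothesis is needed. -/
theorem geometricallyReduced_tensorObj (X Y : Over (Spec (CommRingCat.of k))) [IsAffine X.left]
    [IsAffine Y.left] (hX : GeometricallyReduced X.hom) (hY : GeometricallyReduced Y.hom) :
    GeometricallyReduced (X ⊗ Y).hom := by
  obtain ⟨A, _, _, ⟨eX⟩⟩ := exists_iso_Spec X
  obtain ⟨B, _, _, ⟨eY⟩⟩ := exists_iso_Spec Y
  rw [geometricallyReduced_iff_of_iso_Spec eX] at hX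
  rw [geometricallyReduced_iff_of_iso_Spec eY] at hY
  have e : X ⊗ Y ≅ Over.mk (Spec.map (CommRingCat.ofHom (algebraMap k (A ⊗[k] B)))) :=
    (eX ⊗ᵢ eY) ≪≫ Over.isoMk (pullbackSpecIso k A B) (by
      rw [← Iso.eq_inv_comp]
      change Spec.map _ = _ ≫
        Limits.pullback.fst (Spec.map _) (Spec.map (CommRingCat.ofHom (algebraMap k B))) ≫
          Spec.map _
      rw [pullbackSpecIso_inv_fst_assoc]
      simp [← Spec.map_comp, ← CommRingCat.ofHom_comp])
  rw [geometricallyReduced_iff_of_iso_Spec e]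
  exact hX.tensorProduct hY

theorem geometricallyReduced_tensorUnit :
    GeometricallyReduced (𝟙_ (Over (Spec (CommRingCat.of k)))).hom := by
  rw [geometricallyReduced_iff]
  intro K _ y Z fst snd h
  have : IsIso snd := MorphismProperty.of_isPullback (P := .isomorphisms Scheme) h
    (inferInstanceAs (IsIso (𝟙 _)))
  exact isReduced_of_isOpenImmersion snd

instance isAffine_tensorObj_left (X Y : Over (Spec (CommRingCat.of k))) [IsAffine X.left]
    [IsAffine Y.left] : IsAffine (X ⊗ Y).left :=
  inferInstanceAs (IsAffine (Limits.pullback X.hom Y.hom))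

instance isAffine_tensorUnit_left : IsAffine (𝟙_ (Over (Spec (CommRingCat.of k)))).left :=
  inferInstanceAs (IsAffine (Spec (CommRingCat.of k)))

/-- An affine `k`-scheme `X` has a largest geometrically reduced closed subscheme `Q`: every
morphism to `X` from a geometrically reduced affine `k`-scheme factors through `Q`. -/
theorem exists_largest_geometricallyReduced (X : Over (Spec (CommRingCat.of k)))
    [IsAffine X.left] :
    ∃ (Q : Over (Spec (CommRingCat.of k))) (j : Q ⟶ X), IsAffine Q.left ∧ Mono j ∧
      GeometricallyReduced Q.hom ∧ ∀ (T : Over (Spec (CommRingCat.of k))) (f : T ⟶ X),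
        IsAffine T.left → GeometricallyReduced T.hom → ∃ g : T ⟶ Q, g ≫ j = f := by
  obtain ⟨A, _, _, ⟨e⟩⟩ := exists_iso_Spec X
  let I := Algebra.IsUniversallyReduced.ideal k A
  let q : CommRingCat.of A ⟶ CommRingCat.of (A ⧸ I) := CommRingCat.ofHom (Ideal.Quotient.mk I)
  let j : Over.mk (Spec.map (CommRingCat.ofHom (algebraMap k (A ⧸ I)))) ⟶
      Over.mk (Spec.map (CommRingCat.ofHom (algebraMap k A))) :=
    Over.homMk (Spec.map q) (by
      simp only [Over.mk_hom, q, ← Spec.map_comp, ← CommRingCat.ofHom_comp])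
  have : IsClosedImmersion j.left := IsClosedImmersion.spec_of_surjective q
    Ideal.Quotient.mk_surjective
  have : Mono j := Over.mono_of_mono_left j
  refine ⟨_, j ≫ e.inv, inferInstanceAs (IsAffine (Spec _)), inferInstance,
    geometricallyReduced_Spec_iff.mpr (Algebra.IsUniversallyReduced.quotient_ideal k A),
    fun T f _ hT ↦ ?_⟩
  obtain ⟨B, _, _, ⟨e'⟩⟩ := exists_iso_Spec T
  rw [geometricallyReduced_iff_of_iso_Spec e'] at hT
  obtain ⟨φ, hφ⟩ := Spec.map_surjective (e'.inv ≫ f ≫ e.hom).left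
  have h_comp : φ.hom.comp (algebraMap k A) = algebraMap k B := by
    have := Over.w (e'.inv ≫ f ≫ e.hom)
    rw [← hφ] at this
    simp only [Over.mk_hom, ← Spec.map_comp] at this
    exact congr($(Spec.map_injective this).hom)
  let φ' : A →ₐ[k] B := { φ.hom with commutes' := fun r ↦ congr($h_comp r) }
  let ψ : A ⧸ I →ₐ[k] B := Ideal.Quotient.liftₐ I φ'
    fun a ha ↦ Algebra.IsUniversallyReduced.ideal_le_ker hT φ' ha
  let g : Over.mk (Spec.map (CommRingCat.ofHom (algebraMap k B))) ⟶
      Over.mk (Spec.map (CommRingCat.ofHom (algebraMap k (A ⧸ I)))) :=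
    Over.homMk (Spec.map (CommRingCat.ofHom ψ.toRingHom)) (by
      simp only [Over.mk_hom, ← Spec.map_comp, ← CommRingCat.ofHom_comp]
      congr 2)
  have hg : g ≫ j = e'.inv ≫ f ≫ e.hom := by
    ext1
    rw [← hφ]
    change Spec.map _ ≫ Spec.map _ = _
    rw [← Spec.map_comp]
    rfl
  exact ⟨e'.hom ≫ g, by simp [reassoc_of% hg]⟩

end

end AlgebraicGeometry

/-! ### The largest geometrically reduced subgroup -/

open MonoidalCategory MonObj in
/-- An affine group scheme `P` over `k` has a geometrically reduced closed subgroup through which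
every homomorphism from a geometrically reduced affine group scheme factors. -/
theorem KGroup.exists_largest_geometricallyReduced {k : Type u} [Field k] (P : KGroup k) :
    ∃ (Q : KGroup k) (j : Q ⟶ P), Mono j ∧ Q.IsGeometricallyReduced ∧
      ∀ (G : KGroup k) (f : G ⟶ P), G.IsGeometricallyReduced → ∃ g : G ⟶ Q, g ≫ j = f := by
  have : IsAffine P.obj.X.left := P.property
  obtain ⟨Q, j, _, _, hQ, h⟩ := AlgebraicGeometry.exists_largest_geometricallyReduced P.obj.X
  obtain ⟨one, h_one⟩ := h _ η[P.obj.X] inferInstance geometricallyReduced_tensorUnit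
  obtain ⟨mul, h_mul⟩ := h (Q ⊗ Q) ((j ⊗ₘ j) ≫ μ) inferInstance
    (geometricallyReduced_tensorObj Q Q hQ hQ)
  obtain ⟨inv, h_inv⟩ := h Q (j ≫ GrpObj.inv) inferInstance hQ
  let : GrpObj Q := .ofMono j one mul inv h_one h_mul h_inv
  have : IsMonHom j := { one_hom := h_one, mul_hom := h_mul }
  let Q' : KGroup k := ⟨⟨Q⟩, ‹IsAffine Q.left›⟩
  let j' : Q' ⟶ P := ObjectProperty.homMk (Grp.homMk j)
  refine ⟨Q', j', ⟨fun a b hab ↦ ?_⟩, hQ, fun G f hG ↦ ?_⟩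
  · ext : 2
    exact (cancel_mono j).mp congr($(hab).hom.hom.hom)
  · obtain ⟨g, hg⟩ := h G.obj.X f.hom.hom.hom G.property hG
    have : IsMonHom g :=
      { one_hom := by
          rw [← cancel_mono j, Category.assoc, hg, IsMonHom.one_hom, IsMonHom.one_hom]
        mul_hom := by
          rw [← cancel_mono j, Category.assoc, hg, IsMonHom.mul_hom, Category.assoc,
            IsMonHom.mul_hom, tensorHom_comp_tensorHom_assoc, hg] }
    exact ⟨ObjectProperty.homMk (Grp.homMk (A := G.obj) (B := Q'.obj) g), by ext : 2; exact hg⟩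

theorem mainTheorem7 {k : Type u} [Field k] {H G₁ G₂ P : KGroup k}
    (φ₁ : H ⟶ G₁) (φ₂ : H ⟶ G₂) (i₁ : G₁ ⟶ P) (i₂ : G₂ ⟶ P)
    (hP : KGroup.IsAmalgamatedFreeProduct φ₁ φ₂ i₁ i₂)
    (h₁ : G₁.IsGeometricallyReduced) (h₂ : G₂.IsGeometricallyReduced) :
    P.IsGeometricallyReduced := by
  -- The maps `i₁` and `i₂` factor through `Q`, so the universal property of `P` gives a section
  -- of the inclusion of `Q` in `P`.
  obtain ⟨Q, j, _, hQ, h⟩ := P.exists_largest_geometricallyReduced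
  obtain ⟨g₁, hg₁⟩ := h G₁ i₁ h₁
  obtain ⟨g₂, hg₂⟩ := h G₂ i₂ h₂
  have hw : φ₁ ≫ g₁ = φ₂ ≫ g₂ := by
    rw [← cancel_mono j, Category.assoc, Category.assoc, hg₁, hg₂]
    exact hP.toCommSq.w
  let s : P ⟶ Q := CategoryTheory.IsPushout.desc hP g₁ g₂ hw
  have hs : s ≫ j = 𝟙 P := by
    refine CategoryTheory.IsPushout.hom_ext hP ?_ ?_
    · rw [CategoryTheory.IsPushout.inl_desc_assoc hP, hg₁, Category.comp_id]
    · rw [CategoryTheory.IsPushout.inr_desc_assoc hP, hg₂, Category.comp_id]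
  have : IsSplitEpi j := ⟨⟨s, hs⟩⟩
  have : IsIso j := isIso_of_mono_of_isSplitEpi j
  let F := (affineGroupProperty k).ι ⋙ Grp.forget (Over (Spec (CommRingCat.of k)))
  exact (geometricallyReduced_iff_of_iso (F.mapIso (asIso j))).mp hQ
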